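/- All vector spaces are real. A Banach lattice is a Banach space that is also a vector lattice and whose norm satisfies $\|x\|\le\|y\|$ whenever $|x|\le|y|$; the cone of elements $x\ge 0$ of $E$ is denoted $E_+$. The norm dual $E'$ of a Banach lattice $E$ carries the dual norm and the order $f\le g \iff f(x)\le g(x)$ for all $x\in E_+$. The norm of a Banach lattice is order continuous if $\|x_\alpha\|\to 0$ for every decreasing net $(x_\alpha)$ with infimum $0$. Operators are continuous linear maps; an operator $T:E\to F$ between Banach lattices is positive if $T(E_+)\subseteq F_+$, and Dunford–Pettis if $\|Tx_n\|\to 0$ for every weakly null sequence $(x_n)$ in $E$. A sequence $(x_n)$ in $E$ is uaw-null if $|x_n|\wedge u\to 0$ weakly for every $u\in E_+$, and $T$ is uaw-Dunford–Pettis if $\|Tx_n\|\to 0$ for every norm bounded uaw-null sequence $(x_n)$ in $E$. **Theorem 3.1.** Let $E$ and $F$ be Banach lattices. The following assertions are equivalent: 1. Each positive Dunford–Pettis operator $T:E\to F$ is uaw-Dunford–Pettis. 2. Each positive compact operator $T:E\to F$ is uaw-Dunford–Pettis. 3. The norm of $E'$ is order continuous, or $F=\{0\}$. -/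

import Mathlib

open Filter Topology

/-- The order of the norm dual `E'` of an ordered normed space: `f ≤ g` iff `f x ≤ g x` for every
`x` in the positive cone of `E`. Antisymmetry uses that the positive cone generates `E`. -/
abbrev dualPartialOrder (E : Type*) [NormedAddCommGroup E] [NormedSpace ℝ E] [Lattice E]
    [IsOrderedAddMonoid E] : PartialOrder (StrongDual ℝ E) where
  le f g := ∀ x : E, 0 ≤ x → f x ≤ g x
  le_refl _ _ _ := le_rfl
  le_trans _ _ _ h₁ h₂ x hx := (h₁ x hx).trans (h₂ x hx)
  le_antisymm f g h₁ h₂ := by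
    have h : ∀ x : E, 0 ≤ x → f x = g x := fun x hx => le_antisymm (h₁ x hx) (h₂ x hx)
    ext x
    rw [← posPart_sub_negPart x, map_sub, map_sub, h _ (posPart_nonneg x),
      h _ (negPart_nonneg x)]

/-- The norm of `X` is order continuous: `x_α ↓ 0` implies `‖x_α‖ → 0`, for all nets `(x_α)` in
`X`. Here `x_α ↓ 0` means that the net is decreasing with infimum `0`. The range of a decreasing
net is a downward directed subset of `X`, so index sets in the universe of `X` suffice. -/
def HasOrderContinuousNorm.{u} (X : Type u) [NormedAddCommGroup X] [PartialOrder X] : Prop :=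
  ∀ (ι : Type u) [Preorder ι] [IsDirectedOrder ι] [Nonempty ι] (x : ι → X),
    Antitone x → IsGLB (Set.range x) 0 → Tendsto (fun i => ‖x i‖) atTop (𝓝 0)

/-- The norm of the dual `E'` is order continuous. -/
def HasOrderContinuousDualNorm (E : Type*) [NormedAddCommGroup E] [NormedSpace ℝ E] [Lattice E]
    [IsOrderedAddMonoid E] : Prop :=
  @HasOrderContinuousNorm (StrongDual ℝ E) _ (dualPartialOrder E)

/-- Convergence in the weak topology `σ(X, X')`. -/
def WeakTendsto {ι X : Type*} [NormedAddCommGroup X] [NormedSpace ℝ X]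
    (x : ι → X) (l : Filter ι) (a : X) : Prop :=
  Tendsto (fun i => toWeakSpace ℝ X (x i)) l (𝓝 (toWeakSpace ℝ X a))

/-- Unbounded absolute weak convergence: `|x_i - a| ⊓ u → 0` weakly for each `u` in the positive
cone. -/
def UawTendsto {ι E : Type*} [NormedAddCommGroup E] [NormedSpace ℝ E] [Lattice E]
    (x : ι → E) (l : Filter ι) (a : E) : Prop :=
  ∀ u : E, 0 ≤ u → WeakTendsto (fun i => |x i - a| ⊓ u) l 0

/-- A positive operator maps the positive cone into the positive cone. -/
def IsPositiveOperator {E F : Type*} [NormedAddCommGroup E] [NormedSpace ℝ E] [Lattice E]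
    [NormedAddCommGroup F] [NormedSpace ℝ F] [Lattice F] (T : E →L[ℝ] F) : Prop :=
  ∀ x : E, 0 ≤ x → 0 ≤ T x

/-- A Dunford–Pettis operator maps weakly null sequences to norm null sequences. -/
def IsDunfordPettis {X Y : Type*} [NormedAddCommGroup X] [NormedSpace ℝ X]
    [NormedAddCommGroup Y] [NormedSpace ℝ Y] (T : X →L[ℝ] Y) : Prop :=
  ∀ x : ℕ → X, WeakTendsto x atTop 0 → Tendsto (fun n => ‖T (x n)‖) atTop (𝓝 0)

/-- A uaw-Dunford–Pettis operator maps norm bounded uaw-null sequences to norm null sequences. -/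
def IsUawDunfordPettis {E X : Type*} [NormedAddCommGroup E] [NormedSpace ℝ E] [Lattice E]
    [NormedAddCommGroup X] [NormedSpace ℝ X] (T : E →L[ℝ] X) : Prop :=
  ∀ x : ℕ → E, (∃ C : ℝ, ∀ n, ‖x n‖ ≤ C) → UawTendsto x atTop 0 →
    Tendsto (fun n => ‖T (x n)‖) atTop (𝓝 0)

/-! Everything turns on one property of a positive functional `f`: it tends to zero along bounded
disjoint positive sequences. A gliding-hump construction
(`almost_order_bounded_of_tendsto_of_disjoint`) upgrades this to: for each `ε` some `u ≥ 0` has `f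
(x - u)⁺ ≤ ε` on the whole positive unit ball.

If `E'` has order continuous norm, the components of `f` on disjoint bands have tail sums decreasing
to zero, hence null in norm, which gives the property. Splitting `|x n|` into `|x n| ⊓ u` and `(|x
n| - u)⁺` then shows that bounded uaw-null sequences are weakly null, and Dunford–Pettis operators
send these to norm null sequences.

Conversely, given `y ≠ 0` in `F`, the rank-one operator `x ↦ f x • |y|` is positive and compact.
Disjoint sequences are uaw-null, so its uaw-Dunford–Pettis property yields the property of `f`, and
the uniform bound returns order continuity. Compact operators being Dunford–Pettis closes the cycle.
-/

lemma inf_eq_zero_of_le {E : Type*} [Lattice E] [Zero E] {a b c d : E} (ha : 0 ≤ a)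
    (hb : 0 ≤ b) (hac : a ≤ c) (hbd : b ≤ d) (h : c ⊓ d = 0) : a ⊓ b = 0 :=
  le_antisymm (h ▸ inf_le_inf hac hbd) (le_inf ha hb)

/-! ### Disjointness in vector lattices -/

section VectorLattice

variable {E : Type*} [Lattice E] [AddCommGroup E] [IsOrderedAddMonoid E]

lemma add_inf_le_inf_add_inf {x y w : E} (hx : 0 ≤ x) (hy : 0 ≤ y) (hw : 0 ≤ w) :
    (x + y) ⊓ w ≤ x ⊓ w + y ⊓ w := by
  have h : (x + y) ⊓ w - y ⊓ w ≤ x ⊓ w := by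
    refine le_inf ?_ ?_
    · rw [sub_le_iff_le_add, add_inf]
      exact inf_le_inf le_rfl (le_add_of_nonneg_left hx)
    · rw [sub_le_iff_le_add]
      exact inf_le_right.trans (le_add_of_nonneg_right (le_inf hy hw))
  exact sub_le_iff_le_add.1 h

lemma inf_add_inf_le_add_inf (x y v w : E) : x ⊓ v + y ⊓ w ≤ (x + y) ⊓ (v + w) :=
  le_inf (add_le_add inf_le_left inf_le_left) (add_le_add inf_le_right inf_le_right)

lemma add_inf_eq_zero {a b c : E} (ha : 0 ≤ a) (hb : 0 ≤ b) (hc : 0 ≤ c) (hac : a ⊓ c = 0)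
    (hbc : b ⊓ c = 0) : (a + b) ⊓ c = 0 :=
  le_antisymm ((add_inf_le_inf_add_inf ha hb hc).trans (by rw [hac, hbc, add_zero]))
    (le_inf (add_nonneg ha hb) hc)

lemma nsmul_inf_eq_zero {a c : E} (ha : 0 ≤ a) (hc : 0 ≤ c) (hac : a ⊓ c = 0) (k : ℕ) :
    (k • a) ⊓ c = 0 := by
  induction k with
  | zero => simpa using hc
  | succ k ih =>
    rw [succ_nsmul]
    exact add_inf_eq_zero (nsmul_nonneg ha k) ha hc ih hac

lemma sum_inf_eq_zero {ι : Type*} (s : Finset ι) {a : ι → E} {c : E} (ha : ∀ i, 0 ≤ a i)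
    (hc : 0 ≤ c) (h : ∀ i ∈ s, a i ⊓ c = 0) : (∑ i ∈ s, a i) ⊓ c = 0 := by
  classical
  induction s using Finset.induction_on with
  | empty => simpa using hc
  | insert i s hi ih =>
    rw [Finset.sum_insert hi]
    exact add_inf_eq_zero (ha i) (Finset.sum_nonneg fun j _ => ha j) hc
      (h i (Finset.mem_insert_self i s)) (ih fun j hj => h j (Finset.mem_insert_of_mem hj))

lemma sum_le_of_pairwise_inf_eq_zero {ι : Type*} (s : Finset ι) {a : ι → E} {x : E}
    (ha : ∀ i, 0 ≤ a i) (hx : 0 ≤ x) (hd : Pairwise fun i j => a i ⊓ a j = 0)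
    (hax : ∀ i, a i ≤ x) : ∑ i ∈ s, a i ≤ x := by
  classical
  induction s using Finset.induction_on with
  | empty => simpa using hx
  | insert i s hi ih =>
    have h : a i ⊓ ∑ j ∈ s, a j = 0 := by
      rw [inf_comm]
      exact sum_inf_eq_zero s ha (ha i) fun j hj => hd (ne_of_mem_of_not_mem hj hi)
    -- The sum of two disjoint elements is their supremum.
    rw [Finset.sum_insert hi, ← inf_add_sup, h, zero_add]
    exact sup_le (hax i) ih

lemma eq_inf_add_posPart_sub (x u : E) : x = x ⊓ u + (x - u)⁺ := by
  rw [inf_eq_sub_posPart_sub, sub_add_cancel]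

lemma pairwise_inf_inf_eq_zero {w : ℕ → E} (hw : ∀ i, 0 ≤ w i)
    (hd : Pairwise fun i j => w i ⊓ w j = 0) {x : E} (hx : 0 ≤ x) (k : ℕ) :
    Pairwise fun i j => (x ⊓ k • w i) ⊓ (x ⊓ k • w j) = 0 := by
  intro i j hij
  refine inf_eq_zero_of_le (le_inf hx (nsmul_nonneg (hw i) k)) (le_inf hx (nsmul_nonneg (hw j) k))
    inf_le_right inf_le_right (nsmul_inf_eq_zero (hw i) (nsmul_nonneg (hw j) k) ?_ k)
  rw [inf_comm]
  exact nsmul_inf_eq_zero (hw j) (hw i) (hd hij.symm) k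

end VectorLattice

section SolidNorm

variable {E : Type*} [NormedAddCommGroup E] [Lattice E] [IsOrderedAddMonoid E] [HasSolidNorm E]

lemma norm_le_norm_of_nonneg_of_le {x y : E} (hx : 0 ≤ x) (h : x ≤ y) : ‖x‖ ≤ ‖y‖ :=
  norm_le_norm_of_abs_le_abs (by rwa [abs_of_nonneg hx, abs_of_nonneg (hx.trans h)])

lemma norm_posPart_le (x : E) : ‖x⁺‖ ≤ ‖x‖ :=
  norm_le_norm_of_abs_le_abs (by
    rw [abs_of_nonneg (posPart_nonneg x)]
    exact sup_le (le_abs_self x) (abs_nonneg x))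

lemma norm_negPart_le (x : E) : ‖x⁻‖ ≤ ‖x‖ := by
  simpa using norm_posPart_le (-x)

end SolidNorm

/-! ### Positive functionals: extension, decomposition, band components -/

section Functionals

variable {E : Type*} [NormedAddCommGroup E] [NormedSpace ℝ E] [Lattice E]
  [IsOrderedAddMonoid E]

lemma StrongDual.mono_of_nonneg {f : StrongDual ℝ E} (hf : ∀ x, 0 ≤ x → 0 ≤ f x) {x y : E}
    (h : x ≤ y) : f x ≤ f y := by
  have := hf (y - x) (sub_nonneg.2 h)
  rwa [map_sub, sub_nonneg] at this

lemma StrongDual.abs_apply_le_of_nonneg {f : StrongDual ℝ E} (hf : ∀ x, 0 ≤ x → 0 ≤ f x) (x : E) :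
    |f x| ≤ f |x| :=
  abs_le.2 ⟨by rw [← map_neg]; exact mono_of_nonneg hf (neg_le.1 (neg_le_abs x)),
    mono_of_nonneg hf (le_abs_self x)⟩

variable [HasSolidNorm E]

/-- A norm bounded additive function on the positive cone extends to a continuous functional. -/
lemma exists_strongDual_of_additive_on_nonneg (p : E → ℝ) (C : ℝ)
    (hadd : ∀ x y, 0 ≤ x → 0 ≤ y → p (x + y) = p x + p y)
    (hbd : ∀ x, 0 ≤ x → |p x| ≤ C * ‖x‖) :
    ∃ g : StrongDual ℝ E, ∀ x, 0 ≤ x → g x = p x := by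
  have hC : ∀ x : E, |p x⁺ - p x⁻| ≤ 2 * |C| * ‖x‖ := fun x => by
    have h1 := (hbd _ (posPart_nonneg x)).trans
      (mul_le_mul (le_abs_self C) (norm_posPart_le x) (norm_nonneg _) (abs_nonneg C))
    have h2 := (hbd _ (negPart_nonneg x)).trans
      (mul_le_mul (le_abs_self C) (norm_negPart_le x) (norm_nonneg _) (abs_nonneg C))
    linarith [abs_sub (p x⁺) (p x⁻)]
  have p0 : p 0 = 0 := by simpa using hadd 0 0 le_rfl le_rfl
  let g : E →+ ℝ :=
    { toFun := fun x => p x⁺ - p x⁻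
      map_zero' := by simp
      map_add' := fun x y => by
        have h : (x + y)⁺ + (x⁻ + y⁻) = (x + y)⁻ + (x⁺ + y⁺) := by
          have e : ∀ z : E, z⁺ = z + z⁻ := fun z => by
            rw [← sub_eq_iff_eq_add, posPart_sub_negPart]
          rw [e (x + y), e x, e y]
          abel
        have h' := congrArg p h
        rw [hadd _ _ (posPart_nonneg _) (add_nonneg (negPart_nonneg _) (negPart_nonneg _)),
          hadd _ _ (negPart_nonneg _) (negPart_nonneg _),
          hadd _ _ (negPart_nonneg _) (add_nonneg (posPart_nonneg _) (posPart_nonneg _)),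
          hadd _ _ (posPart_nonneg _) (posPart_nonneg _)] at h'
        linarith }
  have hg : Continuous g := AddMonoidHomClass.continuous_of_bound g (2 * |C|) hC
  -- Homogeneity is automatic: continuous additive maps are real linear.
  refine ⟨g.toRealLinearMap hg, fun x hx => ?_⟩
  change p x⁺ - p x⁻ = p x
  rw [posPart_of_nonneg hx, negPart_of_nonneg hx, p0, sub_zero]

lemma exists_le_strongDual_of_additive_on_nonneg (p : E → ℝ) (f : StrongDual ℝ E)
    (hadd : ∀ x y, 0 ≤ x → 0 ≤ y → p (x + y) = p x + p y)
    (h0 : ∀ x, 0 ≤ x → 0 ≤ p x) (hle : ∀ x, 0 ≤ x → p x ≤ f x) :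
    ∃ g : StrongDual ℝ E, ∀ x, 0 ≤ x → g x = p x :=
  exists_strongDual_of_additive_on_nonneg p ‖f‖ hadd fun x hx => by
    rw [abs_of_nonneg (h0 x hx)]
    exact (hle x hx).trans ((le_abs_self _).trans (f.le_opNorm x))

/-- Every functional is a difference of two positive functionals. -/
lemma exists_nonneg_sub_nonneg (g : StrongDual ℝ E) :
    ∃ f₁ f₂ : StrongDual ℝ E, (∀ x, 0 ≤ x → 0 ≤ f₁ x) ∧ (∀ x, 0 ≤ x → 0 ≤ f₂ x) ∧
      g = f₁ - f₂ := by
  let S : E → Set ℝ := fun x => g '' Set.Icc 0 x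
  have hle : ∀ x y, y ∈ Set.Icc 0 x → g y ≤ ‖g‖ * ‖x‖ := fun x y hy =>
    (le_abs_self _).trans ((g.le_opNorm y).trans
      (mul_le_mul_of_nonneg_left (norm_le_norm_of_nonneg_of_le hy.1 hy.2) (norm_nonneg g)))
  have hbdd : ∀ x, BddAbove (S x) := fun x =>
    ⟨‖g‖ * ‖x‖, by rintro _ ⟨y, hy, rfl⟩; exact hle x y hy⟩
  have hmem : ∀ x y, 0 ≤ y → y ≤ x → g y ≤ sSup (S x) := fun x y h1 h2 =>
    le_csSup (hbdd x) ⟨y, ⟨h1, h2⟩, rfl⟩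
  have h0 : ∀ x, 0 ≤ x → 0 ≤ sSup (S x) := fun x hx => by simpa using hmem x 0 le_rfl hx
  have hne : ∀ x, 0 ≤ x → (S x).Nonempty := fun x hx => ⟨g 0, 0, ⟨le_rfl, hx⟩, rfl⟩
  -- Riesz–Kantorovich: `f₁` is the positive part of `g`. Additivity rests on splitting `z ≤ x + y`
  -- into `z ⊓ x ≤ x` and `z - z ⊓ x ≤ y`.
  obtain ⟨f₁, hf₁⟩ := exists_strongDual_of_additive_on_nonneg (fun x => sSup (S x)) ‖g‖
    (fun x y hx hy => by
      refine le_antisymm (csSup_le (hne _ (add_nonneg hx hy)) ?_) ?_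
      · rintro _ ⟨z, hz, rfl⟩
        have h1 := hmem x (z ⊓ x) (le_inf hz.1 hx) inf_le_right
        have h2 := hmem y (z - z ⊓ x) (sub_nonneg.2 inf_le_left) (by
          rw [sub_le_iff_le_add, add_inf]
          exact le_inf (le_add_of_nonneg_left hy) (by rw [add_comm]; exact hz.2))
        rw [map_sub] at h2
        linarith
      · rw [← le_sub_iff_add_le]
        refine csSup_le (hne x hx) ?_
        rintro _ ⟨a, ha, rfl⟩
        rw [le_sub_comm]
        refine csSup_le (hne y hy) ?_
        rintro _ ⟨b, hb, rfl⟩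
        have := hmem (x + y) (a + b) (add_nonneg ha.1 hb.1) (add_le_add ha.2 hb.2)
        rw [map_add] at this
        linarith)
    (fun x hx => by
      rw [abs_of_nonneg (h0 x hx)]
      refine csSup_le (hne x hx) ?_
      rintro _ ⟨y, hy, rfl⟩
      exact hle x y hy)
  refine ⟨f₁, f₁ - g, fun x hx => by rw [hf₁ x hx]; exact h0 x hx, fun x hx => ?_, by simp⟩
  rw [sub_apply, hf₁ x hx, sub_nonneg]
  exact hmem x x hx le_rfl

/-- The component `x ↦ ⨆ k, f (x ⊓ k • w)` of a positive functional `f` on the band generated by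
`w`. -/
lemma exists_component {f : StrongDual ℝ E} (hf : ∀ x, 0 ≤ x → 0 ≤ f x) {w : E} (hw : 0 ≤ w) :
    ∃ g : StrongDual ℝ E, ∀ x, 0 ≤ x →
      (Monotone fun k : ℕ => f (x ⊓ k • w)) ∧
      Tendsto (fun k : ℕ => f (x ⊓ k • w)) atTop (𝓝 (g x)) := by
  have hmono : ∀ x, Monotone fun k : ℕ => f (x ⊓ k • w) := fun x k l hkl =>
    StrongDual.mono_of_nonneg hf (inf_le_inf le_rfl (nsmul_le_nsmul_left hw hkl))
  have hbdd : ∀ x, BddAbove (Set.range fun k : ℕ => f (x ⊓ k • w)) := fun x =>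
    ⟨f x, by rintro _ ⟨k, rfl⟩; exact StrongDual.mono_of_nonneg hf inf_le_left⟩
  have hlim := fun x => tendsto_atTop_ciSup (hmono x) (hbdd x)
  obtain ⟨g, hg⟩ := exists_le_strongDual_of_additive_on_nonneg
    (fun x => ⨆ k : ℕ, f (x ⊓ k • w)) f
    (fun x y hx hy => by
      refine le_antisymm (ciSup_le fun k => ?_) ?_
      · calc f ((x + y) ⊓ k • w) ≤ f (x ⊓ k • w + y ⊓ k • w) :=
              StrongDual.mono_of_nonneg hf
                (add_inf_le_inf_add_inf hx hy (nsmul_nonneg hw k))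
          _ ≤ _ := by
              rw [map_add]
              exact add_le_add (le_ciSup (hbdd x) k) (le_ciSup (hbdd y) k)
      · refine le_of_tendsto' ((hlim x).add (hlim y)) fun k => ?_
        -- Two truncations at level `k` add up to at most the truncation at level `2k`.
        refine le_trans ?_ (le_ciSup (hbdd (x + y)) (k + k))
        rw [← map_add, add_nsmul]
        exact StrongDual.mono_of_nonneg hf (inf_add_inf_le_add_inf _ _ _ _))
    (fun x hx => (hf _ (le_inf hx (nsmul_nonneg hw 0))).trans (le_ciSup (hbdd x) 0))
    (fun x _ => ciSup_le fun k => StrongDual.mono_of_nonneg hf inf_le_left)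
  exact ⟨g, fun x hx => ⟨hmono x, by rw [hg x hx]; exact hlim x⟩⟩

end Functionals

lemma summable_of_disjoint_of_le {E : Type*} [NormedAddCommGroup E] [NormedSpace ℝ E]
    [Lattice E] [IsOrderedAddMonoid E] {f : StrongDual ℝ E} (hf : ∀ x, 0 ≤ x → 0 ≤ f x) {a : ℕ → E}
    {u : E} (hu : 0 ≤ u) (ha : ∀ i, 0 ≤ a i) (hd : Pairwise fun i j => a i ⊓ a j = 0)
    (hau : ∀ i, a i ≤ u) : Summable fun i => f (a i) :=
  summable_of_sum_range_le (fun i => hf _ (ha i)) fun n => by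
    rw [← map_sum]
    exact StrongDual.mono_of_nonneg hf (sum_le_of_pairwise_inf_eq_zero _ ha hu hd hau)

/-! ### Disjoint sequences and order continuity of the dual norm -/

section BanachLattice

variable {E : Type*} [NormedAddCommGroup E] [NormedSpace ℝ E] [Lattice E]
  [IsOrderedAddMonoid E] [HasSolidNorm E]

lemma weakTendsto_zero_iff {ι X : Type*} [NormedAddCommGroup X] [NormedSpace ℝ X] {x : ι → X}
    {l : Filter ι} :
    WeakTendsto x l 0 ↔ ∀ g : StrongDual ℝ X, Tendsto (fun i => g (x i)) l (𝓝 0) := by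
  have h := WeakBilin.tendsto_iff_forall_eval_tendsto (topDualPairing ℝ X).flip
    (f := fun i => toWeakSpace ℝ X (x i)) (l := l) (x := toWeakSpace ℝ X 0) (by
      intro a b hab
      by_contra hne
      obtain ⟨g, hg⟩ := SeparatingDual.exists_separating_of_ne (R := ℝ) hne
      exact hg (LinearMap.congr_fun hab g))
  refine h.trans (forall_congr' fun g => ?_)
  change Tendsto (fun i => g (x i)) l (𝓝 (g 0)) ↔ _
  rw [map_zero]

/-- Positive functionals suffice to test for weak convergence to zero of the absolute values. -/
lemma weakTendsto_zero_of_forall_nonneg {ι : Type*} {x : ι → E} {l : Filter ι}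
    (h : ∀ f : StrongDual ℝ E, (∀ x, 0 ≤ x → 0 ≤ f x) → Tendsto (fun i => f |x i|) l (𝓝 0)) :
    WeakTendsto x l 0 := by
  refine weakTendsto_zero_iff.2 fun g => ?_
  obtain ⟨f₁, f₂, h₁, h₂, rfl⟩ := exists_nonneg_sub_nonneg g
  have key : ∀ f : StrongDual ℝ E, (∀ x, 0 ≤ x → 0 ≤ f x) →
      Tendsto (fun i => f (x i)) l (𝓝 0) := fun f hf =>
    squeeze_zero_norm (fun i => StrongDual.abs_apply_le_of_nonneg hf (x i)) (h f hf)
  simpa using (key f₁ h₁).sub (key f₂ h₂)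

/-- Disjoint sequences are uaw-null. -/
lemma uawTendsto_zero_of_disjoint {w : ℕ → E} (hw : ∀ i, 0 ≤ w i)
    (hd : Pairwise fun i j => w i ⊓ w j = 0) : UawTendsto w atTop 0 := by
  intro u hu
  refine weakTendsto_zero_of_forall_nonneg fun f hf => ?_
  have h0 : ∀ i, 0 ≤ w i ⊓ u := fun i => le_inf (hw i) hu
  have : Summable fun i => f (w i ⊓ u) := summable_of_disjoint_of_le hf hu h0
    (fun i j hij => inf_eq_zero_of_le (h0 i) (h0 j) inf_le_left inf_le_left (hd hij))
    fun i => inf_le_right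
  simpa [abs_of_nonneg (hw _), abs_of_nonneg (h0 _)] using this.tendsto_atTop_zero

/-- If the dual norm is order continuous, bounded disjoint positive sequences are weakly null. -/
lemma HasOrderContinuousDualNorm.tendsto_of_disjoint (hE : HasOrderContinuousDualNorm E)
    {f : StrongDual ℝ E} (hf : ∀ x, 0 ≤ x → 0 ≤ f x) {w : ℕ → E} {C : ℝ} (hw : ∀ i, 0 ≤ w i)
    (hd : Pairwise fun i j => w i ⊓ w j = 0) (hC : ∀ i, ‖w i‖ ≤ C) :
    Tendsto (fun i => f (w i)) atTop (𝓝 0) := by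
  choose g hg using fun i => exists_component hf (hw i)
  have hg0 : ∀ i x, 0 ≤ x → 0 ≤ g i x := fun i x hx =>
    ge_of_tendsto' (hg i x hx).2 fun k => hf _ (le_inf hx (nsmul_nonneg (hw i) k))
  have hsum : ∀ (s : Finset ℕ) x, 0 ≤ x → ∑ i ∈ s, g i x ≤ f x := fun s x hx => by
    refine le_of_tendsto' (tendsto_finsetSum s fun i _ => (hg i x hx).2) fun k => ?_
    rw [← map_sum]
    exact StrongDual.mono_of_nonneg hf (sum_le_of_pairwise_inf_eq_zero s
      (fun i => le_inf hx (nsmul_nonneg (hw i) k)) hx (pairwise_inf_inf_eq_zero hw hd hx k)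
      fun i => inf_le_left)
  have hsummable : ∀ x, 0 ≤ x → Summable fun i => g i x := fun x hx =>
    summable_of_sum_le (fun i => hg0 i x hx) fun s => hsum s x hx
  obtain ⟨G, hG⟩ := exists_le_strongDual_of_additive_on_nonneg (fun x => ∑' i, g i x) f
    (fun x y hx hy => by
      simp only [map_add]
      exact (hsummable x hx).tsum_add (hsummable y hy))
    (fun x hx => tsum_nonneg fun i => hg0 i x hx)
    (fun x hx => (hsummable x hx).tsum_le_of_sum_le fun s => hsum s x hx)
  -- The tails `∑ i ≥ n, g i` decrease to zero in `E'`; `ULift` puts the index set in the required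
  -- universe.
  let φ : ULift ℕ → StrongDual ℝ E := fun n => G - ∑ i ∈ Finset.range n.down, g i
  have hφ : ∀ n x, φ n x = G x - ∑ i ∈ Finset.range n.down, g i x := fun n x => by
    simp [φ]
  have hlim := hE (ULift ℕ) φ
    (fun m n hmn x hx => by
      rw [hφ, hφ]
      refine sub_le_sub_left (Finset.sum_le_sum_of_subset_of_nonneg
        (Finset.range_mono (ULift.down_le.2 hmn)) fun i _ _ => hg0 i x hx) _)
    ⟨by
      rintro _ ⟨n, rfl⟩ x hx
      rw [hφ, hG x hx, zero_apply, sub_nonneg]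
      exact (hsummable x hx).sum_le_tsum _ fun i _ => hg0 i x hx,
    fun h hh x hx => by
      have h1 : Tendsto (fun n : ℕ => φ ⟨n⟩ x) atTop (𝓝 0) := by
        simp only [hφ, hG x hx]
        simpa using (hsummable x hx).hasSum.tendsto_sum_nat.const_sub (∑' i, g i x)
      exact ge_of_tendsto' h1 fun n => hh ⟨⟨n⟩, rfl⟩ x hx⟩
  have hlim' : Tendsto (fun n : ℕ => ‖φ ⟨n⟩‖ * C) atTop (𝓝 0) := by
    have hup : Tendsto (ULift.up : ℕ → ULift ℕ) atTop atTop :=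
      tendsto_atTop_atTop.2 fun b => ⟨b.down, fun a h => h⟩
    simpa using (hlim.comp hup).mul_const C
  refine squeeze_zero (fun n => hf _ (hw n)) (fun n => ?_) hlim'
  calc f (w n) ≤ g n (w n) := by
        -- The truncation at `k = 1` is already `w n`.
        simpa using (hg n (w n) (hw n)).1.ge_of_tendsto (hg n (w n) (hw n)).2 1
    _ ≤ φ ⟨n⟩ (w n) := by
        rw [hφ, hG _ (hw n), le_sub_iff_add_le, add_comm, ← Finset.sum_range_succ]
        exact (hsummable _ (hw n)).sum_le_tsum _ fun i _ => hg0 i _ (hw n)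
    _ ≤ ‖φ ⟨n⟩‖ * ‖w n‖ := (le_abs_self _).trans ((φ ⟨n⟩).le_opNorm _)
    _ ≤ ‖φ ⟨n⟩‖ * C := mul_le_mul_of_nonneg_left (hC n) (norm_nonneg _)

/-- If the unit ball is order bounded up to an arbitrarily small error with respect to every
positive functional, then the dual norm is order continuous. -/
lemma hasOrderContinuousDualNorm_of_almost_order_bounded
    (h : ∀ f : StrongDual ℝ E, (∀ x, 0 ≤ x → 0 ≤ f x) → ∀ ε > 0, ∃ u : E, 0 ≤ u ∧
      ∀ x, 0 ≤ x → ‖x‖ ≤ 1 → f (x - u)⁺ ≤ ε) :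
    HasOrderContinuousDualNorm E := by
  intro ι _ _ _ φ hanti hglb
  have hφ0 : ∀ i x, 0 ≤ x → 0 ≤ φ i x := fun i x hx => hglb.1 ⟨i, rfl⟩ x hx
  have hmono : ∀ x, 0 ≤ x → Antitone fun i => φ i x := fun x hx i j hij => hanti hij x hx
  have hbdd : ∀ x, 0 ≤ x → BddBelow (Set.range fun i => φ i x) := fun x hx =>
    ⟨0, by rintro _ ⟨i, rfl⟩; exact hφ0 i x hx⟩
  have hlim := fun x hx => tendsto_atTop_ciInf (hmono x hx) (hbdd x hx)
  obtain ⟨i₀⟩ := ‹Nonempty ι›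
  obtain ⟨ψ, hψ⟩ := exists_le_strongDual_of_additive_on_nonneg (fun x => ⨅ i, φ i x) (φ i₀)
    (fun x y hx hy => tendsto_nhds_unique (hlim (x + y) (add_nonneg hx hy)) (by
      simpa only [map_add] using (hlim x hx).add (hlim y hy)))
    (fun x hx => le_ciInf fun i => hφ0 i x hx)
    (fun x hx => ciInf_le (hbdd x hx) i₀)
  -- The pointwise infimum is itself a lower bound in `E'`, so infimum zero means pointwise
  -- convergence to zero on the cone.
  have hψ0 : ∀ x, 0 ≤ x → ψ x ≤ 0 := hglb.2 (by
    rintro _ ⟨i, rfl⟩ x hx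
    rw [hψ x hx]
    exact ciInf_le (hbdd x hx) i)
  rw [tendsto_order]
  refine ⟨fun a ha => Eventually.of_forall fun i => ha.trans_le (norm_nonneg _), fun ε hε => ?_⟩
  obtain ⟨u, hu, hb⟩ := h (φ i₀) (hφ0 i₀) (ε / 3) (by positivity)
  have hsmall : ∀ᶠ i in atTop, φ i u < ε / 3 :=
    (hlim u hu).eventually_lt_const (by
      rw [← hψ u hu]
      exact (hψ0 u hu).trans_lt (by positivity))
  filter_upwards [hsmall, eventually_ge_atTop i₀] with i hi hii
  refine lt_of_le_of_lt (b := ε / 3 + ε / 3) ?_ (by linarith)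
  refine ContinuousLinearMap.opNorm_le_of_unit_norm (by positivity) fun x hx => ?_
  calc ‖φ i x‖ ≤ φ i |x| := StrongDual.abs_apply_le_of_nonneg (hφ0 i) x
    _ = φ i (|x| ⊓ u) + φ i (|x| - u)⁺ := by
        rw [← map_add, ← eq_inf_add_posPart_sub]
    _ ≤ φ i u + φ i₀ (|x| - u)⁺ :=
        add_le_add (StrongDual.mono_of_nonneg (hφ0 i) inf_le_right)
          (hmono _ (posPart_nonneg _) hii)
    _ ≤ ε / 3 + ε / 3 :=
        add_le_add hi.le (hb _ (abs_nonneg x) (by rw [norm_abs_eq_norm, hx]))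

/-! ### Disjointification and uaw-null sequences -/

variable [IsOrderedModule ℝ E] [CompleteSpace E]

/-- If `f` tends to zero along every disjoint positive sequence in the unit ball, then the unit
ball is order bounded up to an arbitrarily small error with respect to `f`. -/
lemma almost_order_bounded_of_tendsto_of_disjoint {f : StrongDual ℝ E}
    (hf : ∀ x, 0 ≤ x → 0 ≤ f x)
    (h : ∀ w : ℕ → E, (∀ i, 0 ≤ w i) → (Pairwise fun i j => w i ⊓ w j = 0) →
      (∀ i, ‖w i‖ ≤ 1) → Tendsto (fun i => f (w i)) atTop (𝓝 0)) {ε : ℝ} (hε : 0 < ε) :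
    ∃ u : E, 0 ≤ u ∧ ∀ x, 0 ≤ x → ‖x‖ ≤ 1 → f (x - u)⁺ ≤ ε := by
  by_contra! hcon
  have hcon' : ∀ u : E, ∃ x, 0 ≤ x ∧ ‖x‖ ≤ 1 ∧ (0 ≤ u → ε < f (x - u)⁺) := fun u => by
    by_cases hu : 0 ≤ u
    · obtain ⟨x, h1, h2, h3⟩ := hcon u hu
      exact ⟨x, h1, h2, fun _ => h3⟩
    · exact ⟨0, le_rfl, by simp, fun h => absurd h hu⟩
  choose pick hp0 hp1 hpε using hcon'
  -- Greedy choice: `x n` violates the bound for `u = 4 ^ n • S n`, where `S n` sums the earlier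
  -- choices.
  let S : ℕ → E := fun n => Nat.rec 0 (fun n s => s + pick ((4 : ℝ) ^ n • s)) n
  let x : ℕ → E := fun n => pick ((4 : ℝ) ^ n • S n)
  have hx0 : ∀ n, 0 ≤ x n := fun n => hp0 _
  have hx1 : ∀ n, ‖x n‖ ≤ 1 := fun n => hp1 _
  have hS : ∀ n, S n = ∑ i ∈ Finset.range n, x i := fun n => by
    induction n with
    | zero => rfl
    | succ n ih => rw [Finset.sum_range_succ, ← ih]
  have hS0 : ∀ n, 0 ≤ S n := fun n => by
    rw [hS]
    exact Finset.sum_nonneg fun i _ => hx0 i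
  have hxS : ∀ m n, m < n → x m ≤ S n := fun m n hmn => by
    rw [hS]
    exact Finset.single_le_sum (fun i _ => hx0 i) (Finset.mem_range.2 hmn)
  have hsum : Summable fun n => ((1 : ℝ) / 2) ^ n • x n :=
    Summable.of_norm_bounded summable_geometric_two fun n => by
      rw [norm_smul, norm_pow, Real.norm_of_nonneg (by norm_num : (0 : ℝ) ≤ 1 / 2)]
      exact mul_le_of_le_one_right (by positivity) (hx1 n)
  obtain ⟨y, hy⟩ := hsum
  have hpow : ∀ n : ℕ, (0 : ℝ) ≤ (1 / 2) ^ n := fun n => by positivity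
  have hterm : ∀ n, 0 ≤ ((1 : ℝ) / 2) ^ n • x n := fun n => smul_nonneg (hpow n) (hx0 n)
  have hxy : ∀ n, ((1 : ℝ) / 2) ^ n • x n ≤ y := fun n => le_hasSum hy n fun i _ => hterm i
  have hy0 : 0 ≤ y := (hterm 0).trans (hxy 0)
  -- For `m < n` put `z = x m - 2^{-(m+n)} x n`. Subtracting the `y` term gives `w m ≤ z⁺`,
  -- subtracting the `S` term gives `w n ≤ 2^{m+n} z⁻`, so the two are disjoint. The `y` term costs
  -- only `2^{-n} f y`.
  let w : ℕ → E := fun n => (x n - (4 : ℝ) ^ n • S n - ((1 : ℝ) / 2) ^ n • y)⁺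
  have h4S : ∀ n, 0 ≤ (4 : ℝ) ^ n • S n := fun n => smul_nonneg (by positivity) (hS0 n)
  have h2y : ∀ n, 0 ≤ ((1 : ℝ) / 2) ^ n • y := fun n => smul_nonneg (hpow n) hy0
  have hdisj : ∀ m n, m < n → w m ⊓ w n = 0 := fun m n hmn => by
    have hm : w m ≤ (x m - ((1 : ℝ) / 2) ^ (m + n) • x n)⁺ := by
      refine posPart_mono ?_
      have h1 : ((1 : ℝ) / 2) ^ (m + n) • x n ≤ ((1 : ℝ) / 2) ^ m • y := by
        rw [pow_add, mul_smul]
        exact smul_le_smul_of_nonneg_left (hxy n) (hpow m)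
      exact sub_le_sub (sub_le_self _ (h4S m)) h1
    have hn : w n ≤ (2 : ℝ) ^ (m + n) • (x m - ((1 : ℝ) / 2) ^ (m + n) • x n)⁻ := by
      have h1 : (2 : ℝ) ^ (m + n) • x m ≤ (4 : ℝ) ^ n • S n := by
        have h2 : (2 : ℝ) ^ (m + n) ≤ 4 ^ n := by
          rw [show (4 : ℝ) = 2 ^ 2 by norm_num, ← pow_mul]
          exact pow_le_pow_right₀ (by norm_num) (by omega)
        exact (smul_le_smul_of_nonneg_right h2 (hx0 m)).trans
          (smul_le_smul_of_nonneg_left (hxS m n hmn) (by positivity))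
      refine sup_le ?_ (smul_nonneg (by positivity) (negPart_nonneg _))
      calc x n - (4 : ℝ) ^ n • S n - ((1 : ℝ) / 2) ^ n • y
          ≤ x n - (2 : ℝ) ^ (m + n) • x m := (sub_le_self _ (h2y n)).trans (sub_le_sub_left h1 _)
        _ = (2 : ℝ) ^ (m + n) • -(x m - ((1 : ℝ) / 2) ^ (m + n) • x n) := by
            rw [neg_sub, smul_sub, smul_smul, ← mul_pow]
            norm_num
        _ ≤ _ := smul_le_smul_of_nonneg_left (neg_le_negPart _) (by positivity)
    have hz := nsmul_inf_eq_zero (negPart_nonneg _) (posPart_nonneg _)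
      ((inf_comm _ _).trans (posPart_inf_negPart_eq_zero
        (x m - ((1 : ℝ) / 2) ^ (m + n) • x n))) (2 ^ (m + n))
    refine inf_eq_zero_of_le (posPart_nonneg _) (posPart_nonneg _) hm ?_ ((inf_comm _ _).trans hz)
    rw [← Nat.cast_smul_eq_nsmul ℝ]
    exact_mod_cast hn
  have hpair : Pairwise fun i j => w i ⊓ w j = 0 := fun i j hij => by
    rcases hij.lt_or_gt with hlt | hlt
    · exact hdisj i j hlt
    · exact (inf_comm _ _).trans (hdisj j i hlt)
  have hw1 : ∀ n, ‖w n‖ ≤ 1 := fun n =>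
    (norm_le_norm_of_nonneg_of_le (posPart_nonneg _) (sup_le
      ((sub_le_self _ (h2y n)).trans (sub_le_self _ (h4S n))) (hx0 n))).trans (hx1 n)
  have hlim := h w (fun n => posPart_nonneg _) hpair hw1
  have hge : ∀ n, ε - (1 / 2) ^ n * f y ≤ f (w n) := fun n => by
    have h1 : (x n - (4 : ℝ) ^ n • S n)⁺ ≤ w n + ((1 : ℝ) / 2) ^ n • y :=
      sup_le (sub_le_iff_le_add.1 (le_posPart _)) (add_nonneg (posPart_nonneg _) (h2y n))
    have h2 := StrongDual.mono_of_nonneg hf h1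
    rw [map_add, map_smul, smul_eq_mul] at h2
    linarith [hpε _ (h4S n)]
  have hlim2 : Tendsto (fun n : ℕ => ε - (1 / 2) ^ n * f y) atTop (𝓝 ε) := by
    simpa using ((tendsto_pow_atTop_nhds_zero_of_lt_one (by norm_num : (0 : ℝ) ≤ 1 / 2)
      (by norm_num)).mul_const (f y)).const_sub ε
  exact absurd (le_of_tendsto_of_tendsto' hlim2 hlim hge) (not_le.2 hε)

/-- If the dual norm is order continuous, then norm bounded uaw-null sequences are weakly null. -/
lemma HasOrderContinuousDualNorm.weakTendsto_of_uawTendsto (hE : HasOrderContinuousDualNorm E)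
    {x : ℕ → E} {C : ℝ} (hC : ∀ n, ‖x n‖ ≤ C) (hx : UawTendsto x atTop 0) :
    WeakTendsto x atTop 0 := by
  refine weakTendsto_zero_of_forall_nonneg fun f hf => ?_
  have hC' : (0 : ℝ) < |C| + 1 := by positivity
  -- Dividing by `D > 0` moves the sequence into the unit ball; the error `ε / (2 * D)` scales back
  -- to `ε / 2`.
  set D := |C| + 1 with hD
  rw [tendsto_order]
  refine ⟨fun a ha => Eventually.of_forall fun i => ha.trans_le (hf _ (abs_nonneg _)),
    fun ε hε => ?_⟩
  obtain ⟨u, hu, hb⟩ := almost_order_bounded_of_tendsto_of_disjoint hf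
    (fun w hw hd h1 => hE.tendsto_of_disjoint hf hw hd h1) (ε := ε / (2 * D)) (by positivity)
  have hlim := weakTendsto_zero_iff.1 (hx (D • u) (smul_nonneg hC'.le hu)) f
  filter_upwards [hlim.eventually_lt_const (half_pos hε)] with n hn
  rw [sub_zero] at hn
  have hs := hb (D⁻¹ • |x n|) (smul_nonneg (by positivity) (abs_nonneg _)) (by
    rw [norm_smul, norm_abs_eq_norm, norm_inv, Real.norm_of_nonneg hC'.le, inv_mul_le_one₀ hC']
    linarith [hC n, le_abs_self C])
  have hle : (|x n| - D • u)⁺ ≤ D • (D⁻¹ • |x n| - u)⁺ := by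
    refine sup_le ?_ (smul_nonneg hC'.le (posPart_nonneg _))
    calc |x n| - D • u = D • (D⁻¹ • |x n| - u) := by
          rw [smul_sub, smul_inv_smul₀ hC'.ne']
      _ ≤ _ := smul_le_smul_of_nonneg_left (le_posPart _) hC'.le
  calc f |x n| = f (|x n| ⊓ D • u) + f (|x n| - D • u)⁺ := by
        rw [← map_add, ← eq_inf_add_posPart_sub]
    _ ≤ f (|x n| ⊓ D • u) + D * (ε / (2 * D)) := by
        refine add_le_add le_rfl ((StrongDual.mono_of_nonneg hf hle).trans ?_)
        rw [map_smul, smul_eq_mul]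
        exact mul_le_mul_of_nonneg_left hs hC'.le
    _ < ε / 2 + D * (ε / (2 * D)) := by gcongr
    _ = ε := by field_simp; norm_num

end BanachLattice

/-! ### Compact and Dunford–Pettis operators -/

section Operators

variable {X Y : Type*} [NormedAddCommGroup X] [NormedSpace ℝ X] [NormedAddCommGroup Y]
  [NormedSpace ℝ Y]

/-- Uniform boundedness on the dual, which is complete even if `X` is not. -/
lemma WeakTendsto.exists_norm_le {x : ℕ → X} (hx : WeakTendsto x atTop 0) :
    ∃ C, ∀ n, ‖x n‖ ≤ C := by
  obtain ⟨C, hC⟩ := banach_steinhaus (g := fun n => NormedSpace.inclusionInDoubleDual ℝ X (x n))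
    fun g => by
      obtain ⟨C, hC⟩ := (weakTendsto_zero_iff.1 hx g).norm.bddAbove_range
      exact ⟨C, fun n => hC ⟨n, rfl⟩⟩
  exact ⟨C, fun n => ((NormedSpace.inclusionInDoubleDualLi ℝ).norm_map (x n)).symm.trans_le (hC n)⟩

/-- Compact operators are Dunford–Pettis. -/
lemma IsCompactOperator.isDunfordPettis {T : X →L[ℝ] Y} (hT : IsCompactOperator T) :
    IsDunfordPettis T := by
  intro x hx
  obtain ⟨C, hC⟩ := hx.exists_norm_le
  have hK : IsCompact (closure (T '' Metric.closedBall 0 C)) :=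
    IsCompactOperator.isCompact_closure_image_closedBall (f := (T : X →ₗ[ℝ] Y)) hT C
  rw [← tendsto_zero_iff_norm_tendsto_zero]
  refine tendsto_of_subseq_tendsto fun ns hns => ?_
  obtain ⟨z, -, ms, hms, hz⟩ := hK.tendsto_subseq (x := fun n => T (x (ns n))) fun n =>
    subset_closure ⟨x (ns n), by simpa using hC _, rfl⟩
  -- The images also tend weakly to zero, so zero is the only possible subsequential norm limit.
  have hz0 : z = 0 := (SeparatingDual.eq_zero_iff_forall_dual_eq_zero (R := ℝ) z).2 fun g =>
    tendsto_nhds_unique ((g.continuous.tendsto z).comp hz)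
      ((weakTendsto_zero_iff.1 hx (g.comp T)).comp (hns.comp hms.tendsto_atTop))
  exact ⟨ms, hz0 ▸ hz⟩

lemma ContinuousLinearMap.isCompactOperator_smulRight (f : StrongDual ℝ X) (y : Y) :
    IsCompactOperator (f.smulRight y) := by
  have h : IsCompactOperator (id : ℝ → ℝ) := isCompactOperator_id
  exact (h.clm_comp (ContinuousLinearMap.toSpanSingleton ℝ y)).comp_clm f

end Operators

theorem theorem3p1
    {E : Type*} [NormedAddCommGroup E] [NormedSpace ℝ E] [CompleteSpace E] [Lattice E]
    [IsOrderedAddMonoid E] [IsOrderedModule ℝ E] [HasSolidNorm E]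
    {F : Type*} [NormedAddCommGroup F] [NormedSpace ℝ F] [CompleteSpace F] [Lattice F]
    [IsOrderedAddMonoid F] [IsOrderedModule ℝ F] [HasSolidNorm F] :
    List.TFAE
      [∀ T : E →L[ℝ] F, IsPositiveOperator T → IsDunfordPettis T → IsUawDunfordPettis T,
       ∀ T : E →L[ℝ] F, IsPositiveOperator T → IsCompactOperator T → IsUawDunfordPettis T,
       HasOrderContinuousDualNorm E ∨ (∀ y : F, y = 0)] := by
  tfae_have 1 → 2 := fun h T hT hc => h T hT hc.isDunfordPettis
  tfae_have 2 → 3 := by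
    intro h
    by_contra! hcon
    obtain ⟨hE, y, hy⟩ := hcon
    refine hE (hasOrderContinuousDualNorm_of_almost_order_bounded fun f hf ε hε =>
      almost_order_bounded_of_tendsto_of_disjoint hf (fun w hw hd h1 => ?_) hε)
    have hT := h (f.smulRight |y|) (fun x hx => smul_nonneg (hf x hx) (abs_nonneg y))
      (f.isCompactOperator_smulRight _) w ⟨1, h1⟩ (uawTendsto_zero_of_disjoint hw hd)
    have hy' : ‖y‖ ≠ 0 := norm_ne_zero_iff.2 hy
    have := hT.mul_const ‖y‖⁻¹
    rw [zero_mul] at this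
    refine this.congr fun n => ?_
    rw [ContinuousLinearMap.smulRight_apply, norm_smul, norm_abs_eq_norm,
      Real.norm_of_nonneg (hf _ (hw n)), mul_inv_cancel_right₀ hy']
  tfae_have 3 → 1 := by
    rintro (hE | hF) T hT hDP x ⟨C, hC⟩ hx
    · exact hDP x (hE.weakTendsto_of_uawTendsto hC hx)
    · simp [hF (T _)]
  tfae_finish
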